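/- Let $\mathbb N^*=\{1,2,\dots\}$, let $S$ be the left shift $(Sw)(n)=w(n+1)$ on $\{-1,0,1\}^{\mathbb N^*}$ (with the product topology), and let $\log$ denote the logarithm to base $2$. For $w\in\{-1,0,1\}^{\mathbb N^*}$ put $h_{top}(w)=\lim_{n\to\infty}\frac1n\log p_n(w)$, where $p_n(w)$ is the number of blocks of length $n$ appearing in $w$; for an $S$-invariant Borel probability measure $\nu$ put $h_{top}(\operatorname{supp}\nu)=\lim_{n\to\infty}\frac1n\log|\{B\in\{-1,0,1\}^n:\nu(B)>0\}|$, a block $B$ being identified with the cylinder $\{w: w(1)\cdots w(n)=B\}$. A sequence $t$ is Toeplitz if for every $a\in\mathbb N^*$ there is $r_a\in\mathbb N^*$ with $t(a)=t(a+kr_a)$ for all $k\in\mathbb N^*$. A point $z$ is quasi-generic for $\nu$ if $\frac1{N_k}\sum_{n\le N_k}\delta_{S^nz}\to\nu$ weakly for some increasing sequence $(N_k)$. **Theorem.** Let $z\in\{-1,0,1\}^{\mathbb N^*}$ satisfy $$\liminf_{N\to\infty}\frac1N\sum_{n\le N}z(n)^2>0.$$ Suppose that (a) $z$ is quasi-generic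 for some $S$-invariant Borel probability measure $\widetilde\nu$ on $\{-1,0,1\}^{\mathbb N^*}$; (b) $H:=h_{top}(\operatorname{supp}\widetilde\nu)>0$; (c) there exist $q\ge2$ and $b\ge1$ such that, for every $m\ge1$, the number of ergodic components of $S^{q^m}$ acting on $(\{-1,0,1\}^{\mathbb N^*},\widetilde\nu)$ is at most $b$, i.e. $\widetilde\nu$ is a convex combination with positive weights of at most $b$ distinct $S^{q^m}$-invariant ergodic probability measures. Then for every $\varepsilon>0$ there is a Toeplitz sequence $t\in\{-1,0,1\}^{\mathbb N^*}$ such that $$h_{top}(t)\ge(1-\varepsilon)H\qquad\text{and}\qquad\liminf_{N\to\infty}\frac1N\sum_{n\le N}t(n)\,z(n)>0.$$ -/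

import Mathlib

open MeasureTheory Filter Topology
open scoped ENNReal

/-- The alphabet `{-1, 0, 1}` is Mathlib's `SignType` (with its discrete topology); we equip it
with the discrete `σ`-algebra. The space `ℕ+ → SignType` then carries the product topology and the
product (= Borel) `σ`-algebra. -/
instance instMeasurableSpaceSignType : MeasurableSpace SignType := ⊤

namespace SymbDyn

/-- The index `t + j`, for `t ∈ ℕ* = {1, 2, …}` and `j ∈ {0, 1, …}`. -/
def idx (t : ℕ+) (j : ℕ) : ℕ+ := ⟨(t : ℕ) + j, Nat.add_pos_left t.pos j⟩

/-- The left shift `(S w)_n = w_{n+1}` on one-sided sequences. -/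
def shift {A : Type*} (w : ℕ+ → A) : ℕ+ → A := fun n => w (n + 1)

/-- The cylinder `{w : w_{t+j} = a_j for 0 ≤ j ≤ k - 1}` of a block `B = (a_0, …, a_{k-1})`. -/
def cylinder {A : Type*} {k : ℕ} (t : ℕ+) (B : Fin k → A) : Set (ℕ+ → A) :=
  {w | ∀ j : Fin k, w (idx t j) = B j}

/-- The blocks of length `n` which appear in `w`. -/
def blocksOf {A : Type*} (w : ℕ+ → A) (n : ℕ) : Set (Fin n → A) :=
  {B | ∃ t : ℕ+, w ∈ cylinder t B}

/-- The blocks of length `n` whose cylinder (at the first position) has positive measure. -/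
def blocksOfMeasure {A : Type*} [MeasurableSpace A] (ν : Measure (ℕ+ → A)) (n : ℕ) :
    Set (Fin n → A) :=
  {B | 0 < ν (cylinder 1 B)}

/-- Topological entropy `h_top(w) = lim (1/n) log₂ p_n(w)` of a sequence, where `p_n(w)` is the
number of blocks of length `n` appearing in `w`. The limit exists, see `tendsto_htop`. -/
noncomputable def htop {A : Type*} (w : ℕ+ → A) : ℝ :=
  limUnder atTop (fun n : ℕ => Real.logb 2 ((blocksOf w n).ncard : ℝ) / n)

/-- `h_top(supp ν) = lim (1/n) log₂ #{B ∈ A^n : ν(B) > 0}`. For a shift-invariant measure the limit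
exists, see `tendsto_htopSupp`. -/
noncomputable def htopSupp {A : Type*} [MeasurableSpace A] (ν : Measure (ℕ+ → A)) : ℝ :=
  limUnder atTop (fun n : ℕ => Real.logb 2 ((blocksOfMeasure ν n).ncard : ℝ) / n)

/-- The empirical measure `δ_{N,x} = (1/N) ∑_{1 ≤ n ≤ N} δ_{T^n x}`. -/
noncomputable def empiricalMeasure {X : Type*} [MeasurableSpace X] (T : X → X) (N : ℕ) (x : X) :
    Measure X :=
  (N : ℝ≥0∞)⁻¹ • ∑ n ∈ Finset.Icc 1 N, Measure.dirac (T^[n] x)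

/-- `x` is quasi-generic for `ν`: along some increasing sequence `(N_k)`, the empirical measures
`δ_{N_k,x}` converge weakly to `ν`. -/
def IsQuasiGeneric {X : Type*} [TopologicalSpace X] [MeasurableSpace X] (T : X → X) (x : X)
    (ν : Measure X) : Prop :=
  ∃ N : ℕ → ℕ, StrictMono N ∧ ∀ f : C(X, ℝ),
    Tendsto (fun k => ∫ y, f y ∂(empiricalMeasure T (N k) x)) atTop (𝓝 (∫ y, f y ∂ν))

/-- The measure-preserving system `(T, ν)` has exactly `k` ergodic components: its ergodic
decomposition is a convex combination, with nonzero weights, of `k` distinct `T`-invariant ergodic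
probability measures. -/
def HasErgodicComponents {X : Type*} [MeasurableSpace X] (T : X → X) (ν : Measure X) (k : ℕ) :
    Prop :=
  ∃ (ρ : Fin k → Measure X) (α : Fin k → ℝ≥0∞),
    Function.Injective ρ ∧ (∀ i, IsProbabilityMeasure (ρ i)) ∧ (∀ i, Ergodic T (ρ i)) ∧
    (∀ i, α i ≠ 0) ∧ ∑ i, α i = 1 ∧ ν = ∑ i, α i • ρ i

/-- Toeplitz sequences: every position is periodically repeated. -/
def IsToeplitz {A : Type*} (t : ℕ+ → A) : Prop :=
  ∀ a : ℕ+, ∃ r : ℕ+, ∀ k : ℕ+, t a = t (a + k * r)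

/-! ### Existence of the limits defining the entropies -/

lemma exists_tendsto_of_factorial {A : Type*} [Finite A] (P : ∀ n : ℕ, Set (Fin n → A))
    (hP : ∀ m n (B : Fin (m + n) → A), B ∈ P (m + n) →
      (B ∘ Fin.castAdd n) ∈ P m ∧ (B ∘ Fin.natAdd m) ∈ P n) :
    ∃ l : ℝ, Tendsto (fun n : ℕ => Real.logb 2 ((P n).ncard : ℝ) / n) atTop (𝓝 l) := by
  have h2 : (1 : ℝ) < 2 := by norm_num
  have nonneg : ∀ k : ℕ, 0 ≤ Real.logb 2 (k : ℝ) := by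
    intro k
    rcases Nat.eq_zero_or_pos k with rfl | hk
    · simp
    · exact Real.logb_nonneg h2 (by exact_mod_cast hk)
  have hle : ∀ m n, (P (m + n)).ncard ≤ (P m).ncard * (P n).ncard := by
    intro m n
    rw [← Set.ncard_prod]
    refine Set.ncard_le_ncard_of_injOn (fun B => (B ∘ Fin.castAdd n, B ∘ Fin.natAdd m))
      (fun B hB => hP m n B hB) ?_ (Set.toFinite _)
    intro B _ B' _ h
    simp only [Prod.mk.injEq] at h
    funext i
    refine Fin.addCases (fun j => ?_) (fun j => ?_) i
    · exact congrFun h.1 j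
    · exact congrFun h.2 j
  have hsub : Subadditive (fun n : ℕ => Real.logb 2 ((P n).ncard : ℝ)) := by
    intro m n
    have h := hle m n
    rcases Nat.eq_zero_or_pos (P (m + n)).ncard with h0 | h0
    · simp only [h0, Nat.cast_zero, Real.logb_zero]
      exact add_nonneg (nonneg _) (nonneg _)
    · have hmn : 0 < (P m).ncard * (P n).ncard := lt_of_lt_of_le h0 h
      have hm : (P m).ncard ≠ 0 := (Nat.pos_of_mul_pos_right hmn).ne'
      have hn : (P n).ncard ≠ 0 := (Nat.pos_of_mul_pos_left hmn).ne'
      simp only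
      rw [← Real.logb_mul (by exact_mod_cast hm) (by exact_mod_cast hn)]
      exact Real.logb_le_logb_of_le h2 (by exact_mod_cast h0) (by exact_mod_cast h)
  refine ⟨hsub.lim, hsub.tendsto_lim ⟨0, ?_⟩⟩
  rintro _ ⟨n, rfl⟩
  exact div_nonneg (nonneg _) (Nat.cast_nonneg _)

theorem tendsto_htop {A : Type*} [Finite A] (w : ℕ+ → A) :
    Tendsto (fun n : ℕ => Real.logb 2 ((blocksOf w n).ncard : ℝ) / n) atTop (𝓝 (htop w)) := by
  refine tendsto_nhds_limUnder (exists_tendsto_of_factorial (blocksOf w) ?_)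
  rintro m n B ⟨t, ht⟩
  refine ⟨⟨t, fun j => ht (Fin.castAdd n j)⟩, ⟨idx t m, fun j => ?_⟩⟩
  have := ht (Fin.natAdd m j)
  have e : idx (idx t m) j = idx t (Fin.natAdd m j : Fin (m + n)) := by
    apply PNat.eq
    simp [idx, add_assoc]
  rw [e]
  exact this

lemma shift_iterate {A : Type*} (m : ℕ) (w : ℕ+ → A) (n : ℕ+) :
    (shift^[m] w) n = w (idx n m) := by
  induction m generalizing w with
  | zero => rfl
  | succ m ih =>
    rw [Function.iterate_succ_apply, ih]
    rfl

lemma measurableSet_cylinder {A : Type*} [MeasurableSpace A] [MeasurableSingletonClass A]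
    {k : ℕ} (t : ℕ+) (B : Fin k → A) : MeasurableSet (cylinder t B) := by
  have : cylinder t B = ⋂ j : Fin k, (fun w : ℕ+ → A => w (idx t j)) ⁻¹' {B j} := by
    ext w
    simp [cylinder]
  rw [this]
  exact MeasurableSet.iInter fun j => measurable_pi_apply _ (measurableSet_singleton _)

theorem tendsto_htopSupp {A : Type*} [Finite A] [MeasurableSpace A] [MeasurableSingletonClass A]
    (ν : Measure (ℕ+ → A)) (hν : MeasurePreserving shift ν ν) :
    Tendsto (fun n : ℕ => Real.logb 2 ((blocksOfMeasure ν n).ncard : ℝ) / n) atTop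
      (𝓝 (htopSupp ν)) := by
  refine tendsto_nhds_limUnder (exists_tendsto_of_factorial (blocksOfMeasure ν) ?_)
  intro m n B hB
  refine ⟨lt_of_lt_of_le hB (measure_mono fun w hw j => hw (Fin.castAdd n j)), ?_⟩
  have hpre := (hν.iterate m).measure_preimage
    (measurableSet_cylinder 1 (B ∘ Fin.natAdd m)).nullMeasurableSet
  change 0 < ν (cylinder 1 (B ∘ Fin.natAdd m))
  rw [← hpre]
  refine lt_of_lt_of_le hB (measure_mono fun w hw j => ?_)
  have := hw (Fin.natAdd m j)
  rw [shift_iterate]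
  have e : idx (idx 1 j) m = idx 1 (Fin.natAdd m j : Fin (m + n)) := by
    apply PNat.eq
    simp [idx]
    omega
  rw [e]
  exact this

end SymbDyn

open SymbDyn

/-! Write positions from 0. Along rapidly growing periods `p 0 ∣ p 1 ∣ …`, the first `p j` entries
of `z` are copied with period `p (j + 1)` into the places still free. Every place is filled
periodically, so the result `t` is Toeplitz, and `t` agrees with `z` off the overwritten places,
whose density is at most a small `δ`. Hence the correlation of `t` with `z` loses at most a small
multiple of `δ` from the mean of `z ^ 2` (`le_sum_toeplitzOf_mul`).

For entropy, a block `B` of length `p j` and positive measure has frequency `ν(B)` in `z` along a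
subsequence. The periods are chosen so that windows touched at stages `≥ j` have density at most
`ν(B) / 2`, so some occurrence of `B` avoids them (`exists_window`). Earlier stages change at most a
proportion `δ` of any window of length `p j`. Thus `t` contains a block close to `B` in Hamming
distance (`exists_block_near`), and a volume bound for Hamming balls gives `htopSupp ν ≤ htop t +
o(1)` as `δ → 0`. -/

namespace SymbDyn

/-! ### Toeplitz sequences built from a divisibility chain of periods -/

/-- A strictly increasing chain of periods, each dividing the next. -/
structure PeriodChain (p : ℕ → ℕ) : Prop where
  pos : ∀ j, 0 < p j
  dvd : ∀ j, p j ∣ p (j + 1)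
  strictMono : StrictMono p

variable {p : ℕ → ℕ}

lemma PeriodChain.exists_stage (hp : PeriodChain p) (m : ℕ) : ∃ j, m % p (j + 1) < p j :=
  ⟨m + 1, (Nat.mod_le _ _).trans_lt (hp.strictMono.le_apply (x := m + 1))⟩

lemma PeriodChain.dvd_of_le (hp : PeriodChain p) {i j : ℕ} (h : i ≤ j) : p i ∣ p j := by
  induction h with
  | refl => rfl
  | step _ ih => exact ih.trans (hp.dvd _)

open Classical in
/-- The stage at which the position `m` is filled: the first `j` such that the residue of `m`
modulo `p (j + 1)` is less than `p j`. -/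
noncomputable def stage (p : ℕ → ℕ) (m : ℕ) : ℕ :=
  -- The default 0 is never used for a `PeriodChain`, by `exists_stage`.
  if h : ∃ j, m % p (j + 1) < p j then Nat.find h else 0

/-- The position from which the Toeplitz sequence copies its value at `m`. -/
noncomputable def source (p : ℕ → ℕ) (m : ℕ) : ℕ := m % p (stage p m + 1)

/-- The Toeplitz sequence obtained by copying, at stage `j`, the values of `z` at the first `p j`
positions periodically with period `p (j + 1)`, on positions not filled at an earlier stage. -/
noncomputable def toeplitzOf {A : Type*} (p : ℕ → ℕ) (z : ℕ+ → A) : ℕ+ → A :=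
  fun n => z (source p n.natPred).succPNat

/-- The position `m` is overwritten at some stage `i ≥ j`. -/
def Overwritten (p : ℕ → ℕ) (j m : ℕ) : Prop :=
  -- The initial copy is excluded because there `z` is copied onto itself; without `p (i + 1) ≤ m`,
  -- every `m` would qualify for large `i`. The place may already be filled earlier, so this
  -- overcounts.
  ∃ i, j ≤ i ∧ p (i + 1) ≤ m ∧ m % p (i + 1) < p i

lemma PeriodChain.stage_spec (hp : PeriodChain p) (m : ℕ) :
    m % p (stage p m + 1) < p (stage p m) := by
  classical
  rw [stage, dif_pos (hp.exists_stage m)]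
  exact Nat.find_spec (hp.exists_stage m)

/-- All periods tested up to the stage of `m` divide `p (stage p m + 1)`, so no test changes. -/
lemma PeriodChain.stage_add (hp : PeriodChain p) (m k : ℕ) :
    stage p (m + k * p (stage p m + 1)) = stage p m := by
  classical
  have key : ∀ j ≤ stage p m, (m + k * p (stage p m + 1)) % p (j + 1) = m % p (j + 1) := by
    intro j hj
    obtain ⟨c, hc⟩ := hp.dvd_of_le (Nat.succ_le_succ hj)
    simp only [Nat.succ_eq_add_one] at hc
    rw [hc, show k * (p (j + 1) * c) = p (j + 1) * (k * c) by ring, Nat.add_mul_mod_self_left]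
  conv_lhs => rw [stage, dif_pos (hp.exists_stage _)]
  rw [Nat.find_eq_iff]
  refine ⟨by rw [key _ le_rfl]; exact hp.stage_spec m, fun j hj => ?_⟩
  rw [key j hj.le]
  rw [stage, dif_pos (hp.exists_stage m)] at hj
  exact Nat.find_min (hp.exists_stage m) hj

lemma PeriodChain.isToeplitz_toeplitzOf (hp : PeriodChain p) {A : Type*} (z : ℕ+ → A) :
    IsToeplitz (toeplitzOf p z) := by
  intro a
  refine ⟨⟨p (stage p a.natPred + 1), hp.pos _⟩, fun k => ?_⟩
  have e : (a + k * ⟨p (stage p a.natPred + 1), hp.pos _⟩ : ℕ+).natPred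
      = a.natPred + k * p (stage p a.natPred + 1) := by
    simp only [PNat.natPred, PNat.add_coe]
    exact Nat.sub_add_comm a.pos
  have e2 : source p (a + k * ⟨p (stage p a.natPred + 1), hp.pos _⟩ : ℕ+).natPred
      = source p a.natPred := by
    rw [e, source, hp.stage_add, Nat.add_mul_mod_self_right, source]
  simp only [toeplitzOf, e2]

lemma PeriodChain.source_eq (hp : PeriodChain p) {m : ℕ} (h : ¬ Overwritten p 0 m) :
    source p m = m := by
  refine Nat.mod_eq_of_lt ?_
  by_contra! h'
  exact h ⟨_, Nat.zero_le _, h', hp.stage_spec m⟩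

/-! ### Counting overwritten positions -/

-- A start `s` is encoded by a multiple `k * d` and the offset `s + n - k * d < r + n`. Since `d ≤
-- m` forces `k ≥ 1`, the bound has no additive term that would spoil densities.
open Classical in
lemma card_windows_meeting_le (N n d r : ℕ) (hd : 0 < d) :
    ((Finset.range N).filter
      (fun s => ∃ m, s ≤ m ∧ m < s + n ∧ d ≤ m ∧ m % d < r)).card ≤ (N + n) / d * (r + n) := by
  rw [show (N + n) / d * (r + n) = ((Finset.Icc 1 ((N + n) / d)) ×ˢ Finset.range (r + n)).card by
    simp]
  refine le_trans (Finset.card_le_card (t := (Finset.Icc 1 ((N + n) / d) ×ˢ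
    Finset.range (r + n)).image (fun x => x.1 * d + x.2 - n)) ?_) Finset.card_image_le
  intro s hs
  simp only [Finset.mem_filter, Finset.mem_range] at hs
  obtain ⟨hsN, m, h1, h2, h3, h4⟩ := hs
  have hdm := Nat.div_add_mod m d
  rw [mul_comm] at hdm
  simp only [Finset.mem_image, Finset.mem_product, Finset.mem_Icc, Finset.mem_range, Prod.exists]
  refine ⟨m / d, s + n - m / d * d, ⟨⟨(Nat.one_le_div_iff hd).2 h3, Nat.div_le_div_right ?_⟩, ?_⟩, ?_⟩
  all_goals omega

-- Stage `i` contributes at most `(N + n) / p (i + 1) * (2 * p i)`, that is `c / 4 * (N + n) * 2⁻ⁱ`,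
-- and the geometric series sums to at most 2.
open Classical in
lemma PeriodChain.card_windows_overwritten_le (hp : PeriodChain p) {j n : ℕ} (hn : n ≤ p j)
    {c : ℝ} (hc : ∀ i, j ≤ i → (p i : ℝ) * 2 ^ (i + 3) ≤ c * p (i + 1)) (N : ℕ) :
    (((Finset.range N).filter
      (fun s => ∃ m, s ≤ m ∧ m < s + n ∧ Overwritten p j m)).card : ℝ) ≤ c / 2 * (N + n) := by
  have hsub : (Finset.range N).filter (fun s => ∃ m, s ≤ m ∧ m < s + n ∧ Overwritten p j m) ⊆
      (Finset.Ico j (N + n)).biUnion (fun i => (Finset.range N).filter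
        (fun s => ∃ m, s ≤ m ∧ m < s + n ∧ p (i + 1) ≤ m ∧ m % p (i + 1) < p i)) := by
    intro s hs
    simp only [Finset.mem_filter, Finset.mem_range, Finset.mem_biUnion, Finset.mem_Ico] at hs ⊢
    obtain ⟨hsN, m, h1, h2, i, h3, h4, h5⟩ := hs
    -- Only finitely many stages matter: `i + 1 ≤ p (i + 1) ≤ m < N + n`.
    have := hp.strictMono.le_apply (x := i + 1)
    exact ⟨i, ⟨h3, by omega⟩, hsN, m, h1, h2, h4, h5⟩
  have hc0 : 0 ≤ c := by
    have h1 := hc j le_rfl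
    have h2 : (0 : ℝ) < p (j + 1) := by exact_mod_cast hp.pos _
    have h3 : (0 : ℝ) ≤ c * p (j + 1) := le_trans (by positivity) h1
    exact nonneg_of_mul_nonneg_left h3 h2
  have hterm : ∀ i ∈ Finset.Ico j (N + n), (((Finset.range N).filter
        (fun s => ∃ m, s ≤ m ∧ m < s + n ∧ p (i + 1) ≤ m ∧ m % p (i + 1) < p i)).card : ℝ) ≤
        c / 4 * (N + n) * (1 / 2) ^ i := by
    intro i hi
    have hji := (Finset.mem_Ico.1 hi).1
    have h2 : (0 : ℝ) < p (i + 1) := by exact_mod_cast hp.pos _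
    have h0 : (((Finset.range N).filter
        (fun s => ∃ m, s ≤ m ∧ m < s + n ∧ p (i + 1) ≤ m ∧ m % p (i + 1) < p i)).card : ℝ) ≤
        (((N + n) / p (i + 1) * (p i + n) : ℕ) : ℝ) := by
      exact_mod_cast card_windows_meeting_le N n (p (i + 1)) (p i) (hp.pos _)
    have h3 : (((N + n) / p (i + 1) : ℕ) : ℝ) ≤ (N + n) / p (i + 1) := by
      have := Nat.cast_div_le (α := ℝ) (m := N + n) (n := p (i + 1))
      exact_mod_cast this
    have h4 : (n : ℝ) ≤ p i := by exact_mod_cast hn.trans (hp.strictMono.monotone hji)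
    calc _ ≤ _ := h0
      _ ≤ ((N : ℝ) + n) / p (i + 1) * (p i + p i) := by
        push_cast
        gcongr
      _ = ((N : ℝ) + n) * (p i * 2 ^ (i + 3)) / p (i + 1) / 4 * (1 / 2) ^ i := by
        rw [pow_add, one_div, inv_pow]
        field_simp
        ring
      _ ≤ ((N : ℝ) + n) * (c * p (i + 1)) / p (i + 1) / 4 * (1 / 2) ^ i := by
        have := hc i hji
        gcongr
      _ = _ := by field_simp
  calc _ ≤ (((Finset.Ico j (N + n)).biUnion (fun i => (Finset.range N).filter
        (fun s => ∃ m, s ≤ m ∧ m < s + n ∧ p (i + 1) ≤ m ∧ m % p (i + 1) < p i))).card : ℝ) := by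
        exact_mod_cast Finset.card_le_card hsub
    _ ≤ ∑ i ∈ Finset.Ico j (N + n), (((Finset.range N).filter
        (fun s => ∃ m, s ≤ m ∧ m < s + n ∧ p (i + 1) ≤ m ∧ m % p (i + 1) < p i)).card : ℝ) := by
        exact_mod_cast Finset.card_biUnion_le
    _ ≤ ∑ i ∈ Finset.Ico j (N + n), c / 4 * (N + n) * (1 / 2) ^ i := Finset.sum_le_sum hterm
    _ ≤ ∑ i ∈ Finset.range (N + n), c / 4 * (N + n) * (1 / 2) ^ i := by
        refine Finset.sum_le_sum_of_subset_of_nonneg ?_ fun _ _ _ => by positivity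
        intro i hi
        exact Finset.mem_range.2 (Finset.mem_Ico.1 hi).2
    _ ≤ c / 4 * (N + n) * 2 := by
        rw [← Finset.mul_sum]
        have := sum_geometric_two_le (N + n)
        gcongr
    _ = _ := by ring

lemma card_filter_Ico_mod_lt (s c d r : ℕ) (hr : r ≤ d) :
    ((Finset.Ico s (s + c * d)).filter (fun m => m % d < r)).card = c * r := by
  have h1 := Nat.filter_Ico_card_eq_of_periodic s (c * d) (fun m => m % d < r)
    (by simp)
  rw [h1]
  induction c with
  | zero => simp
  | succ c ih =>
    rw [Nat.succ_mul, Nat.count_add, ih (Nat.filter_Ico_card_eq_of_periodic s (c * d) _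
      (by simp)), Nat.succ_mul]
    congr 1
    simp only [Nat.mul_add_mod_self_right]
    rw [Nat.count_eq_card_filter_range]
    have : (Finset.range d).filter (fun k => k % d < r) = Finset.range r := by
      ext k
      simp only [Finset.mem_filter, Finset.mem_range]
      constructor
      · rintro ⟨h, h'⟩
        rwa [Nat.mod_eq_of_lt h] at h'
      · intro h
        exact ⟨h.trans_le hr, by rwa [Nat.mod_eq_of_lt (h.trans_le hr)]⟩
    simp [this]

-- For `i < j` the length `p j` is a multiple of `p (i + 1)`, so the count for stage `i` is exact
-- and independent of `s`.
open Classical in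
lemma PeriodChain.card_window_stage_le (hp : PeriodChain p) {c : ℝ}
    (hc : ∀ i, (p i : ℝ) * 2 ^ (i + 3) ≤ c * p (i + 1)) (j s : ℕ) :
    (((Finset.Ico s (s + p j)).filter
      (fun m => ∃ i < j, m % p (i + 1) < p i)).card : ℝ) ≤ c * p j := by
  have hc0 : 0 ≤ c := by
    have h2 : (0 : ℝ) < p (0 + 1) := by exact_mod_cast hp.pos _
    exact nonneg_of_mul_nonneg_left (le_trans (by positivity) (hc 0)) h2
  have hsub : (Finset.Ico s (s + p j)).filter (fun m => ∃ i < j, m % p (i + 1) < p i) ⊆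
      (Finset.range j).biUnion (fun i => (Finset.Ico s (s + p j)).filter
        (fun m => m % p (i + 1) < p i)) := by
    intro m hm
    simp only [Finset.mem_filter, Finset.mem_range, Finset.mem_biUnion] at hm ⊢
    obtain ⟨h1, i, h2, h3⟩ := hm
    exact ⟨i, h2, h1, h3⟩
  have hterm : ∀ i ∈ Finset.range j, (((Finset.Ico s (s + p j)).filter
        (fun m => m % p (i + 1) < p i)).card : ℝ) ≤ c / 8 * p j * (1 / 2) ^ i := by
    intro i hi
    obtain ⟨k, hk⟩ := hp.dvd_of_le (Nat.succ_le_of_lt (Finset.mem_range.1 hi))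
    rw [Nat.succ_eq_add_one, mul_comm] at hk
    rw [hk, card_filter_Ico_mod_lt _ _ _ _ (hp.strictMono.monotone (Nat.le_succ i))]
    have := hc i
    push_cast
    calc (k : ℝ) * p i = k * (p i * 2 ^ (i + 3)) / 8 * (1 / 2) ^ i := by
          rw [pow_add, one_div, inv_pow]
          field_simp
          norm_num
      _ ≤ k * (c * p (i + 1)) / 8 * (1 / 2) ^ i := by gcongr
      _ = _ := by ring
  calc _ ≤ (((Finset.range j).biUnion (fun i => (Finset.Ico s (s + p j)).filter
        (fun m => m % p (i + 1) < p i))).card : ℝ) := by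
        exact_mod_cast Finset.card_le_card hsub
    _ ≤ ∑ i ∈ Finset.range j, (((Finset.Ico s (s + p j)).filter
        (fun m => m % p (i + 1) < p i)).card : ℝ) := by
        exact_mod_cast Finset.card_biUnion_le
    _ ≤ ∑ i ∈ Finset.range j, c / 8 * p j * (1 / 2) ^ i := Finset.sum_le_sum hterm
    _ ≤ c / 8 * p j * 2 := by
        rw [← Finset.mul_sum]
        have := sum_geometric_two_le j
        gcongr
    _ ≤ _ := by nlinarith [mul_nonneg hc0 (Nat.cast_nonneg (α := ℝ) (p j))]

/-- The factor `2 ^ (j + 3)` makes the densities summable; monotonicity of `K` carries the bound for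
`K (p j)` to all later stages. -/
lemma exists_periodChain {K : ℕ → ℕ} (hK : Monotone K) (hK1 : ∀ n, 1 ≤ K n) :
    ∃ p : ℕ → ℕ, PeriodChain p ∧
      ∀ j i, j ≤ i → (p i : ℝ) * 2 ^ (i + 3) ≤ (K (p j) : ℝ)⁻¹ * p (i + 1) := by
  let p : ℕ → ℕ := fun j => Nat.rec 1 (fun j x => x * 2 ^ (j + 3) * K x) j
  have hs : ∀ j, p (j + 1) = p j * 2 ^ (j + 3) * K (p j) := fun j => rfl
  have hpos : ∀ j, 0 < p j := by
    intro j
    induction j with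
    | zero => exact one_pos
    | succ j ih =>
      rw [hs]
      have := hK1 (p j)
      positivity
  have hmono : StrictMono p := by
    refine strictMono_nat_of_lt_succ fun j => ?_
    rw [hs, mul_assoc]
    refine lt_mul_right (hpos j) ?_
    calc 1 < 2 ^ (j + 3) := Nat.one_lt_two_pow (by omega)
      _ ≤ 2 ^ (j + 3) * K (p j) := Nat.le_mul_of_pos_right _ (hK1 _)
  refine ⟨p, ⟨hpos, fun j => ⟨2 ^ (j + 3) * K (p j), by rw [hs, mul_assoc]⟩, hmono⟩, ?_⟩
  intro j i hji
  rw [hs i]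
  push_cast
  have h1 : (0 : ℝ) < K (p j) := by exact_mod_cast hK1 _
  have h2 : (K (p j) : ℝ) ≤ K (p i) := by exact_mod_cast hK (hmono.monotone hji)
  rw [inv_mul_eq_div, le_div_iff₀ h1]
  gcongr

/-! ### Entropy of a sequence whose blocks approximate a given family -/

lemma sum_pow_hammingDist {A : Type*} [Fintype A] [DecidableEq A] {n : ℕ} (x : ℝ)
    (C : Fin n → A) :
    ∑ B : Fin n → A, x ^ hammingDist B C = (1 + ((Fintype.card A : ℝ) - 1) * x) ^ n := by
  have h1 : ∀ B : Fin n → A, x ^ hammingDist B C = ∏ i, if B i = C i then 1 else x := by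
    intro B
    rw [Finset.prod_ite, Finset.prod_const_one, one_mul, Finset.prod_const]
    rfl
  have h2 : ∀ i : Fin n, ∑ a : A, (if a = C i then (1 : ℝ) else x)
      = 1 + ((Fintype.card A : ℝ) - 1) * x := by
    intro i
    have : ∀ a : A, (if a = C i then (1 : ℝ) else x) = (if a = C i then 1 - x else 0) + x := by
      intro a
      split_ifs <;> ring
    simp only [this, Finset.sum_add_distrib, Finset.sum_ite_eq', Finset.mem_univ, if_true,
      Finset.sum_const, Finset.card_univ, nsmul_eq_mul]
    ring
  simp only [h1]
  rw [← Fintype.prod_sum (fun (i : Fin n) (a : A) => if a = C i then (1 : ℝ) else x)]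
  simp [h2]

/-- If every block of `P` is within Hamming distance `δ n` of a block of `Q`, then `P` is not much
larger than `Q`. -/
lemma ncard_le_of_hammingDist_le {A : Type*} [Fintype A] [DecidableEq A] {n : ℕ}
    {P Q : Set (Fin n → A)} {x δ : ℝ} (hx0 : 0 < x) (hx1 : x ≤ 1)
    (h : ∀ B ∈ P, ∃ C ∈ Q, (hammingDist B C : ℝ) ≤ δ * n) :
    (P.ncard : ℝ) ≤ Q.ncard * (x ^ (-(δ * n)) * (1 + ((Fintype.card A : ℝ) - 1) * x) ^ n) := by
  classical
  rw [Set.ncard_eq_toFinset_card' P, Set.ncard_eq_toFinset_card' Q]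
  -- Chernoff weighting: as `x ≤ 1`, a block within `δ * n` has weight at least 1.
  have key : ∀ B ∈ P.toFinset,
      (1 : ℝ) ≤ ∑ C ∈ Q.toFinset, x ^ (-(δ * n)) * x ^ hammingDist B C := by
    intro B hB
    obtain ⟨C, hC, hd⟩ := h B (Set.mem_toFinset.1 hB)
    refine le_trans ?_ (Finset.single_le_sum (f := fun C => x ^ (-(δ * n)) * x ^ hammingDist B C)
      (fun _ _ => by positivity) (Set.mem_toFinset.2 hC))
    rw [← Real.rpow_natCast, ← Real.rpow_add hx0]
    exact Real.one_le_rpow_of_pos_of_le_one_of_nonpos hx0 hx1 (by linarith)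
  calc (P.toFinset.card : ℝ) = ∑ B ∈ P.toFinset, (1 : ℝ) := by simp
    _ ≤ ∑ B ∈ P.toFinset, ∑ C ∈ Q.toFinset, x ^ (-(δ * n)) * x ^ hammingDist B C :=
        Finset.sum_le_sum key
    _ ≤ ∑ B : Fin n → A, ∑ C ∈ Q.toFinset, x ^ (-(δ * n)) * x ^ hammingDist B C :=
        Finset.sum_le_sum_of_subset_of_nonneg (Finset.subset_univ _)
          fun _ _ _ => Finset.sum_nonneg fun _ _ => by positivity
    _ = ∑ C ∈ Q.toFinset, x ^ (-(δ * n)) * ∑ B : Fin n → A, x ^ hammingDist B C := by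
        rw [Finset.sum_comm]
        simp only [Finset.mul_sum]
    _ = _ := by simp [sum_pow_hammingDist]

lemma blocksOf_nonempty {A : Type*} (w : ℕ+ → A) (n : ℕ) : (blocksOf w n).Nonempty :=
  ⟨fun j => w (idx 1 j), 1, fun _ => rfl⟩

lemma htopSupp_le_htop_add {A : Type*} [Fintype A] [DecidableEq A] [Nonempty A]
    [MeasurableSpace A] [MeasurableSingletonClass A] {ν : Measure (ℕ+ → A)}
    (hν : MeasurePreserving shift ν ν) {t : ℕ+ → A} {L : ℕ → ℕ} (hL : StrictMono L)
    {x δ : ℝ} (hx0 : 0 < x) (hx1 : x ≤ 1) (hδ : 0 ≤ δ)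
    (h : ∀ j, ∀ B ∈ blocksOfMeasure ν (L j), ∃ C ∈ blocksOf t (L j),
      (hammingDist B C : ℝ) ≤ δ * L j) :
    htopSupp ν ≤ htop t +
      (-(δ * Real.logb 2 x) + Real.logb 2 (1 + ((Fintype.card A : ℝ) - 1) * x)) := by
  set u : ℝ := 1 + ((Fintype.card A : ℝ) - 1) * x with hu
  have hcard : (1 : ℝ) ≤ Fintype.card A := by exact_mod_cast Fintype.card_pos
  have hu1 : 1 ≤ u := by
    have := mul_nonneg (sub_nonneg.2 hcard) hx0.le
    linarith
  have hlx : Real.logb 2 x ≤ 0 := Real.logb_nonpos (by norm_num) hx0.le hx1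
  have hlu : 0 ≤ Real.logb 2 u := Real.logb_nonneg (by norm_num) hu1
  have h1 := (tendsto_htopSupp ν hν).comp hL.tendsto_atTop
  have h2 := ((tendsto_htop t).comp hL.tendsto_atTop).add_const
    (-(δ * Real.logb 2 x) + Real.logb 2 u)
  refine le_of_tendsto_of_tendsto h1 h2 ?_
  filter_upwards [eventually_ge_atTop 1] with j hj
  have hLj : (0 : ℝ) < L j := by exact_mod_cast lt_of_lt_of_le hj hL.le_apply
  have hQ : (1 : ℝ) ≤ (blocksOf t (L j)).ncard := by
    exact_mod_cast (Set.ncard_pos (Set.toFinite _)).2 (blocksOf_nonempty t _)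
  have hlQ := Real.logb_nonneg (b := 2) (by norm_num) hQ
  simp only [Function.comp]
  rw [div_add' _ _ _ hLj.ne', div_le_div_iff_of_pos_right hLj]
  rcases Nat.eq_zero_or_pos (blocksOfMeasure ν (L j)).ncard with h0 | h0
  -- Here `ν` may be zero; then the logarithm takes its default value 0.
  · rw [h0, Nat.cast_zero, Real.logb_zero]
    have : 0 ≤ -(δ * Real.logb 2 x) := by nlinarith
    positivity
  · have hle := ncard_le_of_hammingDist_le hx0 hx1 (h j)
    rw [← hu] at hle
    have hl := Real.logb_le_logb_of_le (b := 2) (by norm_num) (by exact_mod_cast h0) hle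
    rw [Real.logb_mul (by positivity) (by positivity), Real.logb_mul (by positivity)
      (by positivity), Real.logb_rpow_eq_mul_logb_of_pos hx0, Real.logb_pow] at hl
    linarith

/-! ### Frequencies of blocks in a quasi-generic point -/

lemma isClopen_cylinder {A : Type*} [TopologicalSpace A] [DiscreteTopology A] {k : ℕ} (t : ℕ+)
    (B : Fin k → A) : IsClopen (cylinder t B) := by
  have : cylinder t B = ⋂ j : Fin k, (fun w : ℕ+ → A => w (idx t j)) ⁻¹' {B j} := by
    ext w
    simp [cylinder]
  rw [this]
  exact isClopen_iInter_of_finite fun j =>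
    (isClopen_discrete _).preimage (continuous_apply _)

-- The indicator of a clopen set is continuous, hence an admissible test function.
open Classical in
lemma IsQuasiGeneric.tendsto_frequency {X : Type*} [TopologicalSpace X] [MeasurableSpace X]
    {T : X → X} {x : X} {ν : Measure X} (h : IsQuasiGeneric T x ν) {U : Set X}
    (hU : IsClopen U) (hUm : MeasurableSet U) :
    ∃ N : ℕ → ℕ, StrictMono N ∧ Tendsto
      (fun k => (((Finset.Icc 1 (N k)).filter (fun n => T^[n] x ∈ U)).card : ℝ) / N k) atTop
      (𝓝 (ν.real U)) := by
  obtain ⟨N, hN, hlim⟩ := h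
  refine ⟨N, hN, ?_⟩
  have h1 := hlim ⟨U.indicator (fun _ => (1 : ℝ)), (IsClopen.continuous_indicator hU continuous_const)⟩
  simp only [ContinuousMap.coe_mk] at h1
  have e : ∀ μ : Measure X, ∫ y, U.indicator (fun _ => (1 : ℝ)) y ∂μ = μ.real U := by
    intro μ
    rw [integral_indicator_const _ hUm, smul_eq_mul, mul_one]
  simp only [e] at h1
  refine h1.congr fun k => ?_
  simp only [empiricalMeasure, Measure.real, Measure.smul_apply, Measure.finsetSum_apply,
    Measure.dirac_apply' _ hUm, smul_eq_mul, ENNReal.toReal_mul, ENNReal.toReal_inv,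
    ENNReal.toReal_natCast]
  rw [div_eq_inv_mul]
  congr 1
  simp only [Set.indicator_apply, Pi.one_apply, Finset.sum_boole, ENNReal.toReal_natCast]

/-! ### Entropy and correlation of the Toeplitz sequence -/

lemma PeriodChain.toeplitzOf_eq (hp : PeriodChain p) {A : Type*} (z : ℕ+ → A) {m : ℕ}
    (h : ¬ Overwritten p 0 m) : toeplitzOf p z m.succPNat = z m.succPNat := by
  rw [toeplitzOf, Nat.natPred_succPNat, hp.source_eq h]

lemma idx_succPNat (s j : ℕ) : idx s.succPNat j = (s + j).succPNat := by
  apply PNat.eq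
  simp only [idx, PNat.mk_coe, Nat.succPNat_coe]
  omega

/-- A block of positive measure appears in a quasi-generic point at some place where no position is
overwritten at a late stage. -/
lemma PeriodChain.exists_window (hp : PeriodChain p) {A : Type*} [Finite A] [TopologicalSpace A]
    [DiscreteTopology A] [MeasurableSpace A] [MeasurableSingletonClass A] {z : ℕ+ → A}
    {ν : Measure (ℕ+ → A)} [IsFiniteMeasure ν] (hgen : IsQuasiGeneric shift z ν) {j n : ℕ}
    (hn : n ≤ p j) {B : Fin n → A} (hB : B ∈ blocksOfMeasure ν n)
    (hc : ∀ i, j ≤ i → (p i : ℝ) * 2 ^ (i + 3) ≤ ν.real (cylinder 1 B) * p (i + 1)) :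
    ∃ s : ℕ, (∀ i : Fin n, z (s + i).succPNat = B i) ∧
      ∀ m, s ≤ m → m < s + n → ¬ Overwritten p j m := by
  classical
  set c := ν.real (cylinder 1 B) with hcdef
  have hc0 : 0 < c := ENNReal.toReal_pos (ne_of_gt hB) (measure_ne_top _ _)
  obtain ⟨N, hN, hlim⟩ := hgen.tendsto_frequency (isClopen_cylinder 1 B)
    (measurableSet_cylinder 1 B)
  have hNtop : Tendsto (fun k => (N k : ℝ)) atTop atTop :=
    tendsto_natCast_atTop_atTop.comp hN.tendsto_atTop
  -- If every occurrence were bad, `3 / 4 * c * N < c / 2 * (N + 1 + n)` would follow, which fails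
  -- once `N > 2 * (1 + n)`.
  obtain ⟨k, hk1, hk2, hk3⟩ := ((hlim.eventually_const_lt (show 3 / 4 * c < c by linarith)).and
    ((hNtop.eventually_gt_atTop 0).and (hNtop.eventually_gt_atTop (2 * (1 + n))))).exists
  rw [lt_div_iff₀ hk2] at hk1
  have hbad := hp.card_windows_overwritten_le hn hc (N k + 1)
  by_contra! hcon
  have hsub : (Finset.Icc 1 (N k)).filter (fun s => shift^[s] z ∈ cylinder 1 B) ⊆
      (Finset.range (N k + 1)).filter
        (fun s => ∃ m, s ≤ m ∧ m < s + n ∧ Overwritten p j m) := by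
    intro s hs
    simp only [Finset.mem_filter, Finset.mem_Icc, Finset.mem_range] at hs ⊢
    obtain ⟨⟨-, h1⟩, h2⟩ := hs
    refine ⟨by omega, hcon s fun i => ?_⟩
    rw [← h2 i, shift_iterate]
    congr 1
    apply PNat.eq
    simp only [idx, Nat.succPNat_coe, PNat.mk_coe, PNat.one_coe]
    omega
  have hle : (((Finset.Icc 1 (N k)).filter (fun s => shift^[s] z ∈ cylinder 1 B)).card : ℝ) ≤
      c / 2 * ((N k + 1 : ℕ) + n) := le_trans (by exact_mod_cast Finset.card_le_card hsub) hbad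
  push_cast at hle
  nlinarith

/-- In the window of `exists_window`, a mismatch can only come from overwriting at a stage below
`j`, and `card_window_stage_le` counts those places. -/
lemma PeriodChain.exists_block_near (hp : PeriodChain p) {A : Type*} [Finite A] [DecidableEq A]
    [TopologicalSpace A] [DiscreteTopology A] [MeasurableSpace A] [MeasurableSingletonClass A]
    {z : ℕ+ → A} {ν : Measure (ℕ+ → A)} [IsFiniteMeasure ν] (hgen : IsQuasiGeneric shift z ν)
    {δ : ℝ} (hδ : ∀ i, (p i : ℝ) * 2 ^ (i + 3) ≤ δ * p (i + 1)) {j : ℕ}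
    {B : Fin (p j) → A} (hB : B ∈ blocksOfMeasure ν (p j))
    (hc : ∀ i, j ≤ i → (p i : ℝ) * 2 ^ (i + 3) ≤ ν.real (cylinder 1 B) * p (i + 1)) :
    ∃ C ∈ blocksOf (toeplitzOf p z) (p j), (hammingDist B C : ℝ) ≤ δ * p j := by
  classical
  obtain ⟨s, hs, hw⟩ := hp.exists_window hgen le_rfl hB hc
  refine ⟨fun i => toeplitzOf p z (s + i).succPNat,
    ⟨s.succPNat, fun i => by rw [idx_succPNat]⟩, ?_⟩
  refine le_trans ?_ (hp.card_window_stage_le hδ j s)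
  rw [hammingDist]
  norm_cast
  refine Finset.card_le_card_of_injOn (fun i : Fin (p j) => s + (i : ℕ)) ?_ ?_
  · intro i hi
    simp only [Finset.coe_filter, Finset.mem_univ, true_and, Set.mem_ofPred_eq] at hi
    simp only [Finset.coe_filter, Finset.mem_Ico, Set.mem_ofPred_eq]
    refine ⟨⟨by omega, by omega⟩, ?_⟩
    have hO : Overwritten p 0 (s + i) := by
      by_contra h
      exact hi (by rw [hp.toeplitzOf_eq z h, hs])
    obtain ⟨l, -, h1, h2⟩ := hO
    refine ⟨l, ?_, h2⟩
    by_contra! hl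
    exact hw (s + i) (by omega) (by omega) ⟨l, hl, h1, h2⟩
  · intro a _ b _ hab
    exact Fin.ext (by simpa using hab)

/-! ### Correlation with `z` -/

lemma sum_Icc_one_pnat {M : Type*} [AddCommMonoid M] (f : ℕ+ → M) (N : ℕ+) :
    ∑ n ∈ Finset.Icc 1 N, f n = ∑ m ∈ Finset.range N, f m.succPNat := by
  refine Finset.sum_bij' (fun n _ => n.natPred) (fun m _ => m.succPNat) ?_ ?_ ?_ ?_ ?_
  · intro n hn
    rw [Finset.mem_range]
    have h1 : (n : ℕ) ≤ N := (Finset.mem_Icc.1 hn).2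
    have h2 := n.pos
    simp only [PNat.natPred]
    omega
  · intro m hm
    refine Finset.mem_Icc.2 ⟨one_le, ?_⟩
    rw [← PNat.coe_le_coe, Nat.succPNat_coe]
    exact Finset.mem_range.1 hm
  · simp
  · simp
  · simp

lemma SignType.sq_sub_two_le_mul (a b : SignType) : (b : ℝ) ^ 2 - 2 ≤ (a : ℝ) * b := by
  cases a <;> cases b <;> norm_num

/-- An overwritten place costs at most 2; their number is bounded using windows of length 1. -/
lemma PeriodChain.le_sum_toeplitzOf_mul (hp : PeriodChain p) (z : ℕ+ → SignType) {δ : ℝ}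
    (hδ : ∀ i, (p i : ℝ) * 2 ^ (i + 3) ≤ δ * p (i + 1)) (N : ℕ+) :
    (∑ n ∈ Finset.Icc 1 N, (z n : ℝ) ^ 2) - δ * (N + 1) ≤
      ∑ n ∈ Finset.Icc 1 N, ((toeplitzOf p z n : SignType) : ℝ) * (z n : ℝ) := by
  classical
  have h1 := hp.card_windows_overwritten_le (j := 0) (n := 1) (hp.pos 0) (fun i _ => hδ i) N
  have h2 : (Finset.range (N : ℕ)).filter (Overwritten p 0) ⊆ (Finset.range (N : ℕ)).filter
      (fun s => ∃ m, s ≤ m ∧ m < s + 1 ∧ Overwritten p 0 m) := fun m hm => by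
    rw [Finset.mem_filter] at hm ⊢
    exact ⟨hm.1, m, le_rfl, Nat.lt_succ_self m, hm.2⟩
  have h3 : (((Finset.range (N : ℕ)).filter (Overwritten p 0)).card : ℝ) ≤ δ / 2 * (N + 1) := by
    have : (((Finset.range (N : ℕ)).filter (Overwritten p 0)).card : ℝ) ≤ _ :=
      Nat.cast_le.2 (Finset.card_le_card h2)
    exact this.trans (by simpa using h1)
  rw [sum_Icc_one_pnat, sum_Icc_one_pnat]
  have h4 : ∀ m : ℕ, (z m.succPNat : ℝ) ^ 2 - (if Overwritten p 0 m then 2 else 0) ≤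
      ((toeplitzOf p z m.succPNat : SignType) : ℝ) * (z m.succPNat : ℝ) := by
    intro m
    split_ifs with h
    · exact SignType.sq_sub_two_le_mul _ _
    · rw [hp.toeplitzOf_eq z h, sq, sub_zero]
  have h5 := Finset.sum_le_sum fun m (_ : m ∈ Finset.range (N : ℕ)) => h4 m
  rw [Finset.sum_sub_distrib, ← Finset.sum_filter, Finset.sum_const, nsmul_eq_mul] at h5
  linarith

lemma PeriodChain.liminf_toeplitzOf_mul_pos (hp : PeriodChain p) (z : ℕ+ → SignType) {δ c : ℝ}
    (hδ : ∀ i, (p i : ℝ) * 2 ^ (i + 3) ≤ δ * p (i + 1)) (hδ0 : 0 ≤ δ) (hδc : 4 * δ ≤ c)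
    (hc : 0 < c)
    (hz : ∀ᶠ N : ℕ+ in atTop, c < (∑ n ∈ Finset.Icc 1 N, (z n : ℝ) ^ 2) / (N : ℝ)) :
    0 < liminf (fun N : ℕ+ =>
      (∑ n ∈ Finset.Icc 1 N, ((toeplitzOf p z n : SignType) : ℝ) * (z n : ℝ)) / (N : ℝ)) atTop := by
  have hN : ∀ N : ℕ+, (1 : ℝ) ≤ N := fun N => by exact_mod_cast (one_le : 1 ≤ N)
  refine lt_of_lt_of_le (half_pos hc) (le_liminf_of_le ?_ ?_)
  -- A real `liminf` is meaningful only with this upper bound.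
  · refine IsCoboundedUnder.of_frequently_le (a := 1) (Frequently.of_forall fun N => ?_)
    have h0 := hN N
    rw [div_le_one (by linarith)]
    calc _ ≤ ∑ n ∈ Finset.Icc 1 N, (1 : ℝ) := Finset.sum_le_sum fun n _ => by
          cases toeplitzOf p z n <;> cases z n <;> norm_num
      _ = N := by simp
  · filter_upwards [hz] with N hzN
    have h0 := hN N
    rw [lt_div_iff₀ (by linarith)] at hzN
    rw [le_div_iff₀ (by linarith)]
    have := hp.le_sum_toeplitzOf_mul z hδ N
    -- `δ * (N + 1) ≤ 2 * δ * N ≤ c / 2 * N`.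
    nlinarith

/-! ### Choice of constants -/

/-- A monotone bound for the inverses of the positive measures of blocks. -/
lemma exists_monotone_inv_le_measure {A : Type*} [Finite A] [MeasurableSpace A]
    (ν : Measure (ℕ+ → A)) [IsFiniteMeasure ν] {δ : ℝ} (hδ : 0 < δ) :
    ∃ K : ℕ → ℕ, Monotone K ∧ (∀ n, 1 ≤ K n) ∧ (∀ n, (K n : ℝ)⁻¹ ≤ δ) ∧
      ∀ n, ∀ B ∈ blocksOfMeasure ν n, (K n : ℝ)⁻¹ ≤ ν.real (cylinder 1 B) := by
  classical
  have := Fintype.ofFinite A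
  let g : ℕ → ℕ := fun n => ∑ B : Fin n → A, ⌈(ν.real (cylinder 1 B))⁻¹⌉₊
  -- The cumulative sum forces monotonicity; null blocks contribute `⌈0⁻¹⌉₊ = 0`.
  refine ⟨fun n => 1 + ⌈δ⁻¹⌉₊ + ∑ m ∈ Finset.range (n + 1), g m, ?_, fun n => ?_, ?_, ?_⟩
  · intro a b hab
    simp only
    gcongr
  · simp only
    omega
  · intro n
    refine inv_le_of_inv_le₀ hδ ((Nat.le_ceil _).trans ?_)
    norm_cast
    simp only
    omega
  · intro n B hB
    have hpos : 0 < ν.real (cylinder 1 B) := ENNReal.toReal_pos (ne_of_gt hB) (measure_ne_top _ _)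
    refine inv_le_of_inv_le₀ hpos ((Nat.le_ceil _).trans ?_)
    norm_cast
    have h1 : ⌈(ν.real (cylinder 1 B))⁻¹⌉₊ ≤ g n :=
      Finset.single_le_sum (f := fun B : Fin n → A => ⌈(ν.real (cylinder 1 B))⁻¹⌉₊)
        (fun _ _ => Nat.zero_le _) (Finset.mem_univ B)
    have h2 : g n ≤ ∑ m ∈ Finset.range (n + 1), g m :=
      Finset.single_le_sum (f := g) (fun _ _ => Nat.zero_le _) (Finset.self_mem_range_succ n)
    simp only
    omega

/-- First `x` makes the second term less than `η / 2`; then `δ₀` does the same, up to equality, for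
the first. -/
lemma exists_entropy_error_le {η : ℝ} (hη : 0 < η) (k : ℝ) :
    ∃ x δ₀ : ℝ, 0 < x ∧ x ≤ 1 ∧ 0 < δ₀ ∧ ∀ δ, 0 ≤ δ → δ ≤ δ₀ →
      -(δ * Real.logb 2 x) + Real.logb 2 (1 + k * x) ≤ η := by
  have hcont : ContinuousAt (fun x : ℝ => Real.logb 2 (1 + k * x)) 0 := by
    refine ContinuousAt.comp (g := Real.logb 2) (Real.continuousAt_logb (by simp)) (by fun_prop)
  have hev : ∀ᶠ x in 𝓝[>] (0 : ℝ), Real.logb 2 (1 + k * x) < η / 2 :=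
    nhdsWithin_le_nhds (hcont.eventually_lt_const (by simpa using half_pos hη))
  obtain ⟨x, hx, hx0, hx1⟩ := (hev.and (Ioo_mem_nhdsGT (zero_lt_one' ℝ))).exists
  have hl : Real.logb 2 x < 0 := Real.logb_neg (by norm_num) hx0 hx1
  refine ⟨x, η / 2 / -Real.logb 2 x, hx0, hx1.le, div_pos (half_pos hη) (neg_pos.2 hl), ?_⟩
  intro δ _ hδ
  rw [le_div_iff₀ (neg_pos.2 hl)] at hδ
  linarith

end SymbDyn

theorem mainTheorem5
    (z : ℕ+ → SignType)
    (hz : 0 < liminf (fun N : ℕ+ => (∑ n ∈ Finset.Icc 1 N, (z n : ℝ) ^ 2) / (N : ℝ)) atTop)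
    (ν : Measure (ℕ+ → SignType)) [IsProbabilityMeasure ν]
    (hν : MeasurePreserving shift ν ν)
    (hgen : IsQuasiGeneric shift z ν)
    (hH : 0 < htopSupp ν)
    (q b : ℕ) (hq : 2 ≤ q) (hb : 1 ≤ b)
    (herg : ∀ m : ℕ, 1 ≤ m → ∃ k : ℕ, k ≤ b ∧ HasErgodicComponents (shift^[q ^ m]) ν k)
    (ε : ℝ) (hε : 0 < ε) :
    ∃ t : ℕ+ → SignType, IsToeplitz t ∧
      (1 - ε) * htopSupp ν ≤ htop t ∧
      0 < liminf (fun N : ℕ+ => (∑ n ∈ Finset.Icc 1 N, (t n : ℝ) * (z n : ℝ)) / (N : ℝ)) atTop := by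
  obtain ⟨c, hc0, hc⟩ := exists_between hz
  have hcz := eventually_lt_of_lt_liminf hc
    (isBoundedUnder_of ⟨0, fun N => div_nonneg (Finset.sum_nonneg fun _ _ => sq_nonneg _)
      (Nat.cast_nonneg _)⟩)
  obtain ⟨x, δ₀, hx0, hx1, hδ₀, hδη⟩ := exists_entropy_error_le (mul_pos hε hH)
    ((Fintype.card SignType : ℝ) - 1)
  -- `δ₀` keeps the entropy loss below `ε * htopSupp ν`, and `c / 4` keeps the correlation positive.
  set δ := min δ₀ (c / 4) with hδ
  have hδ0 : 0 < δ := lt_min hδ₀ (by linarith)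
  obtain ⟨K, hKm, hK1, hKδ, hKB⟩ := exists_monotone_inv_le_measure ν hδ0
  obtain ⟨p, hp, hpK⟩ := exists_periodChain hKm hK1
  have hpδ : ∀ i, (p i : ℝ) * 2 ^ (i + 3) ≤ δ * p (i + 1) := fun i =>
    (hpK i i le_rfl).trans (by gcongr; exact hKδ _)
  refine ⟨toeplitzOf p z, hp.isToeplitz_toeplitzOf z, ?_, hp.liminf_toeplitzOf_mul_pos z hpδ hδ0.le
    (by linarith [min_le_right δ₀ (c / 4)]) hc0 hcz⟩
  have h1 := htopSupp_le_htop_add hν hp.strictMono hx0 hx1 hδ0.le fun j B hB =>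
    hp.exists_block_near hgen hpδ hB fun i hi => (hpK j i hi).trans (by gcongr; exact hKB _ _ hB)
  have h2 := hδη δ hδ0.le (min_le_left _ _)
  linarith
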